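/- Let $p,q\ge 0$ be integers, let $F$ be the unitary Fourier transform on $L_2(\mathbb R^p)$ (resp. $L_2(\mathbb R^q)$), $\langle x\rangle=(1+\|x\|^2)^{1/2}$, $L^t=F^{-1}\langle x\rangle^tF$ (so $L=(I-\Delta)^{1/2}$), $\|f\|_t=\|\langle x\rangle^tFf\|\in[0,\infty]$ for $f\in L_2$ and $t\in\mathbb R$, and $H^t=\{f\in L_2:\|f\|_t<\infty\}$. All norms without index are $L_2$ norms or operator norms. Let $a,b,s>0$ with $s\ge (b-a)/2$. Let $T:L_2(\mathbb R^p)\to L_2(\mathbb R^q)$ be a bounded linear operator such that, for every $r>0$, $\|T\psi\|_r\sim\|\psi\|_{r-a}$ for all $\psi\in L_2(\mathbb R^p)$, i.e. the two sides are comparable up to positive constants that do not depend on $\psi$ (they may depend on $r$); in the boundary case $s=(b-a)/2$ assume this also for $r=0$. Let $\varphi\in H^b(\mathbb R^p)$, with $\varphi\in H^s(\mathbb R^p)$ (which is automatic if $s\le b$). Let $(\alpha_n)$ be a bounded sequence of positive numbers and let, on a probability space, $\hat T=\hat T_n$ be random bounded linear operators $L_2(\mathbb R^p)\to L_2(\mathbb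 R^q)$ and $\hat r=\hat r_n$ random elements of $L_2(\mathbb R^q)$ ($\hat r$ and $\hat T\psi$, for every $\psi$, being strongly measurable). Let $\hat\varphi_{\alpha_n}$ be the Tikhonov-regularised estimator, i.e. almost surely a solution of $$\min_{\psi}\ \|\hat T\psi-\hat r\|^2+\alpha_n\|\psi\|_s^2 .$$ Then there is a constant $C<\infty$ such that for all $n$ $$\mathbb E\|\hat\varphi_{\alpha_n}-\varphi\|_s^2\le C\Big(\frac1{\alpha_n^2}\,\mathbb E\big\|L^{-s}\hat T^*(\hat r-\hat T\varphi)\big\|^2+\alpha_n^{\frac{b-s}{a+s}}+\frac1{\alpha_n^2}\big(\mathbb E\|\hat T-T\|^2+\mathbb E\|\hat T^*-T^*\|^2\big)\alpha_n^{\frac{b-s}{a+s}}\Big),$$ where both sides may be infinite. -/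

import Mathlib

open MeasureTheory FourierTransform
open scoped ENNReal NNReal

noncomputable section

/-- Euclidean space `ℝⁿ`. -/
abbrev Eucl (n : ℕ) : Type := EuclideanSpace ℝ (Fin n)

/-- The Hilbert space `L₂(ℝⁿ)` (complex valued, Lebesgue measure). -/
abbrev L2 (n : ℕ) : Type := Lp ℂ 2 (volume : Measure (Eucl n))

/-- The weight `⟨2πξ⟩ = (1 + ‖2πξ‖²)^{1/2}`.  Mathlib's Fourier transform is
`𝓕 f ξ = ∫ f(y) e^{-2πi⟨y,ξ⟩} dy`, so that, for the unitary transform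
`F f(x) = (2π)^{-n/2} ∫ f(y) e^{i⟨x,y⟩} dy`, one has `F f(x) = (2π)^{-n/2} 𝓕 f(-x/(2π))`; the
substitution `x = -2πξ` turns `⟨x⟩ = (1 + ‖x‖²)^{1/2}` into `⟨2πξ⟩`.  With this weight the multiplier
`𝓕⁻¹ ⟨2πξ⟩ 𝓕 = F⁻¹ ⟨x⟩ F` is exactly `(I - Δ)^{1/2}`. -/
def bracket {n : ℕ} (ξ : Eucl n) : ℝ := Real.sqrt (1 + (2 * Real.pi * ‖ξ‖) ^ 2)

/-- The function `ξ ↦ ⟨2πξ⟩^t (𝓕 f)(ξ)`, where `𝓕` is the Fourier transform on `L₂(ℝⁿ)`. -/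
def weightedFourier {n : ℕ} (t : ℝ) (f : L2 n) : Eucl n → ℂ :=
  fun ξ => ((bracket ξ ^ t : ℝ) : ℂ) * (𝓕 f : L2 n) ξ

/-- The Sobolev norm `‖f‖_t = ‖⟨x⟩^t F f‖ ∈ [0, ∞]` of `f ∈ L₂(ℝⁿ)`, for `t ∈ ℝ`. -/
def sobolevNorm {n : ℕ} (t : ℝ) (f : L2 n) : ℝ≥0∞ :=
  eLpNorm (weightedFourier t f) 2 volume

/-- Membership in `H^t(ℝⁿ) = {f ∈ L₂(ℝⁿ) : ‖f‖_t < ∞}`. -/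
def MemH {n : ℕ} (t : ℝ) (f : L2 n) : Prop := sobolevNorm t f < ∞

open Classical in
/-- The power `L^t = F⁻¹ ⟨x⟩^t F` of `L = (I - Δ)^{1/2}`, with its natural domain, the
`f ∈ L₂(ℝⁿ)` for which `⟨x⟩^t F f` is square integrable (all of `L₂(ℝⁿ)` if `t ≤ 0`, see
`memLp_weightedFourier`); the value outside of the domain is irrelevant. -/
def Lpow {n : ℕ} (t : ℝ) (f : L2 n) : L2 n :=
  if h : MemLp (weightedFourier t f) 2 volume then 𝓕⁻ (h.toLp (weightedFourier t f)) else 0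

/-- For `t ≤ 0` the operator `L^t` is defined on all of `L₂(ℝⁿ)`. -/
theorem memLp_weightedFourier {n : ℕ} {t : ℝ} (ht : t ≤ 0) (f : L2 n) :
    MemLp (weightedFourier t f) 2 volume := by
  have h1 : ∀ ξ : Eucl n, 1 ≤ bracket ξ := fun ξ => by
    unfold bracket
    rw [Real.one_le_sqrt]
    nlinarith [sq_nonneg (2 * Real.pi * ‖ξ‖)]
  refine (Lp.memLp (𝓕 f : L2 n)).of_le_mul (c := 1) ?_ (Filter.Eventually.of_forall fun ξ => ?_)
  · refine AEStronglyMeasurable.mul ?_ (Lp.memLp (𝓕 f : L2 n)).1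
    have : Measurable fun ξ : Eucl n => ((bracket ξ ^ t : ℝ) : ℂ) := by
      unfold bracket
      fun_prop
    exact this.aestronglyMeasurable
  · unfold weightedFourier
    rw [norm_mul, Complex.norm_real, Real.norm_of_nonneg (Real.rpow_nonneg (by linarith [h1 ξ]) t)]
    exact mul_le_mul_of_nonneg_right (Real.rpow_le_one_of_one_le_of_nonpos (h1 ξ) ht)
      (norm_nonneg _)

/-- The norm equivalence `‖T ψ‖_r ∼ ‖ψ‖_{r-a}` on `L₂(ℝᵖ)`: the two sides, in `[0, ∞]`, are
comparable up to positive constants that do not depend on `ψ`. -/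
def SmoothsAt {p q : ℕ} (T : L2 p →L[ℂ] L2 q) (a r : ℝ) : Prop :=
  ∃ c C : ℝ≥0, 0 < c ∧ 0 < C ∧ ∀ ψ : L2 p,
    c * sobolevNorm (r - a) ψ ≤ sobolevNorm r (T ψ) ∧
      sobolevNorm r (T ψ) ≤ C * sobolevNorm (r - a) ψ

/-- The Tikhonov functional `‖S ψ - ρ‖² + α ‖ψ‖_s²`; it is `∞` for `ψ ∉ H^s(ℝᵖ)`. -/
def tikhonovFunctional {p q : ℕ} (s α : ℝ) (S : L2 p →L[ℂ] L2 q) (ρ : L2 q) (ψ : L2 p) : ℝ≥0∞ :=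
  ‖S ψ - ρ‖ₑ ^ 2 + ENNReal.ofReal α * sobolevNorm s ψ ^ 2

/-- `u` solves `min_ψ ‖S ψ - ρ‖² + α ‖ψ‖_s²`. -/
def IsTikhonovSolution {p q : ℕ} (s α : ℝ) (S : L2 p →L[ℂ] L2 q) (ρ : L2 q) (u : L2 p) : Prop :=
  ∀ ψ : L2 p, tikhonovFunctional s α S ρ u ≤ tikhonovFunctional s α S ρ ψ

end

/-! Write `J = L^{-s}`, a self-adjoint contraction whose range contains `H^s`. Substituting `ψ = J
h` turns the penalty into `α‖h‖²`, so the estimator is `J u` with `u` the ordinary Tikhonov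
minimiser for `S J`, where `S` is the estimated operator. Likewise `φ = J v` with `v ∈ H^{b-s}`.

Put `B = T J` and `w = α (B*B + α)⁻¹ v`, the bias for exact operator and data. The Euler equation
for `u` and the equation for `w` give an energy identity for `x = u - v + w`; Cauchy–Schwarz and
Young then bound `‖u - v‖²` by a residual term, `‖w‖²` and an operator-error term
(`norm_sub_sq_le_of_isMinOn`).

For the bias, testing with `w` gives `‖Bw‖² + α‖w‖² ≤ α ‖v‖_{b-s} ‖w‖_{s-b}`. If `s ≤ b`, smoothing
makes `‖w‖_{s-b}` comparable to `‖Bw‖_{a+2s-b}`, which interpolates between `‖Bw‖` and `‖Bw‖_{a+s} ∼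
‖w‖`; hence `‖w‖² ≤ K α^{(b-s)/(a+s)}` (`exists_bias_bound`). All constants are deterministic, so it
remains to integrate. -/

/-! ### Sobolev norms and Bessel potentials on the Fourier side -/

section Sobolev

variable {n : ℕ}

theorem one_le_bracket (ξ : Eucl n) : 1 ≤ bracket ξ := by
  unfold bracket
  rw [Real.one_le_sqrt]
  nlinarith [sq_nonneg (2 * Real.pi * ‖ξ‖)]

theorem bracket_pos (ξ : Eucl n) : 0 < bracket ξ := one_pos.trans_le (one_le_bracket ξ)

theorem aestronglyMeasurable_weightedFourier (t : ℝ) (f : L2 n) :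
    AEStronglyMeasurable (weightedFourier t f) volume := by
  refine AEStronglyMeasurable.mul ?_ (Lp.memLp (𝓕 f : L2 n)).1
  have : Measurable fun ξ : Eucl n => ((bracket ξ ^ t : ℝ) : ℂ) := by
    unfold bracket
    fun_prop
  exact this.aestronglyMeasurable

theorem MemH.memLp {t : ℝ} {f : L2 n} (h : MemH t f) : MemLp (weightedFourier t f) 2 volume :=
  ⟨aestronglyMeasurable_weightedFourier t f, h⟩

theorem enorm_weightedFourier (t : ℝ) (f : L2 n) (ξ : Eucl n) :
    ‖weightedFourier t f ξ‖ₑ = ENNReal.ofReal (bracket ξ ^ t) * ‖(𝓕 f : L2 n) ξ‖ₑ := by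
  unfold weightedFourier
  rw [enorm_mul]
  congr 1
  rw [← ofReal_norm, Complex.norm_real, Real.norm_of_nonneg (Real.rpow_nonneg (bracket_pos ξ).le t)]

theorem weightedFourier_zero (f : L2 n) : weightedFourier 0 f = (𝓕 f : L2 n) := by
  funext ξ
  simp [weightedFourier]

theorem sobolevNorm_zero (f : L2 n) : sobolevNorm 0 f = ‖f‖ₑ := by
  rw [sobolevNorm, weightedFourier_zero, ← Lp.enorm_def, ← ofReal_norm, Lp.norm_fourier_eq,
    ofReal_norm]

theorem sobolevNorm_sq (t : ℝ) (f : L2 n) :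
    sobolevNorm t f ^ 2 = ∫⁻ ξ, ‖weightedFourier t f ξ‖ₑ ^ 2 := by
  rw [sobolevNorm]
  simpa using eLpNorm_nnreal_pow_eq_lintegral (f := weightedFourier t f) (μ := volume)
    (p := 2) two_ne_zero

theorem fourier_Lpow {t : ℝ} {f : L2 n} (h : MemLp (weightedFourier t f) 2 volume) :
    (𝓕 (Lpow t f) : L2 n) =ᵐ[volume] weightedFourier t f := by
  rw [Lpow, dif_pos h, fourier_fourierInv_eq]
  exact h.coeFn_toLp

theorem weightedFourier_Lpow {t : ℝ} {f : L2 n} (h : MemLp (weightedFourier t f) 2 volume)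
    (r : ℝ) : weightedFourier r (Lpow t f) =ᵐ[volume] weightedFourier (r + t) f := by
  filter_upwards [fourier_Lpow h] with ξ hξ
  simp only [weightedFourier] at hξ ⊢
  rw [hξ, Real.rpow_add (bracket_pos ξ)]
  push_cast
  ring

theorem sobolevNorm_Lpow {t : ℝ} {f : L2 n} (h : MemLp (weightedFourier t f) 2 volume) (r : ℝ) :
    sobolevNorm r (Lpow t f) = sobolevNorm (r + t) f :=
  eLpNorm_congr_ae (weightedFourier_Lpow h r)

theorem ext_fourier {f g : L2 n} (h : (𝓕 f : L2 n) =ᵐ[volume] (𝓕 g : L2 n)) : f = g :=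
  (Lp.fourierTransformₗᵢ (Eucl n) ℂ).injective (Lp.ext h)

theorem Lpow_neg_Lpow {t : ℝ} {f : L2 n} (h : MemLp (weightedFourier t f) 2 volume) :
    Lpow (-t) (Lpow t f) = f := by
  have e := weightedFourier_Lpow h (-t)
  rw [neg_add_cancel, weightedFourier_zero] at e
  have h' : MemLp (weightedFourier (-t) (Lpow t f)) 2 volume :=
    (memLp_congr_ae e).2 (Lp.memLp _)
  exact ext_fourier ((fourier_Lpow h').trans e)

/-- By Plancherel the weights `⟨2πξ⟩^t` and `⟨2πξ⟩^{-t}` cancel inside the integral, and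
Cauchy–Schwarz applies, also for infinite norms. -/
theorem enorm_inner_le_sobolevNorm_mul (t : ℝ) (f g : L2 n) :
    ‖inner ℂ f g‖ₑ ≤ sobolevNorm t f * sobolevNorm (-t) g := by
  rw [← Lp.inner_fourier_eq f g, L2.inner_def]
  have hp : ∀ ξ, ‖inner ℂ ((𝓕 f : L2 n) ξ) ((𝓕 g : L2 n) ξ)‖ₑ =
      (‖weightedFourier t f ξ‖ₑ ^ 2) ^ (1 / 2 : ℝ) *
        (‖weightedFourier (-t) g ξ‖ₑ ^ 2) ^ (1 / 2 : ℝ) := by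
    intro ξ
    have hsq : ∀ x : ℝ≥0∞, (x ^ 2) ^ (1 / 2 : ℝ) = x := fun x => by
      rw [← ENNReal.rpow_natCast, ← ENNReal.rpow_mul]; simp
    rw [hsq, hsq, enorm_weightedFourier, enorm_weightedFourier, mul_mul_mul_comm,
      ← ENNReal.ofReal_mul (Real.rpow_nonneg (bracket_pos ξ).le t),
      ← Real.rpow_add (bracket_pos ξ)]
    simp [mul_comm]
  calc _ ≤ ∫⁻ ξ, ‖inner ℂ ((𝓕 f : L2 n) ξ) ((𝓕 g : L2 n) ξ)‖ₑ := enorm_integral_le_lintegral_enorm _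
    _ ≤ _ := by
      simp_rw [hp]
      refine (ENNReal.lintegral_mul_norm_pow_le
        ((aestronglyMeasurable_weightedFourier t f).enorm.pow_const 2)
        ((aestronglyMeasurable_weightedFourier (-t) g).enorm.pow_const 2)
        (by norm_num) (by norm_num) (by norm_num)).trans_eq ?_
      rw [← sobolevNorm_sq, ← sobolevNorm_sq, ← ENNReal.rpow_natCast, ← ENNReal.rpow_natCast,
        ← ENNReal.rpow_mul, ← ENNReal.rpow_mul]
      simp

/-- Hölder's inequality with weights `1 - l` and `l`, applied to the squared Fourier densities in
`[0, ∞]`. -/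
theorem sobolevNorm_interpolation {l : ℝ} (h0 : 0 ≤ l) (h1 : l ≤ 1) (R : ℝ) (f : L2 n) :
    sobolevNorm (l * R) f ≤ ‖f‖ₑ ^ (1 - l) * sobolevNorm R f ^ l := by
  rw [← sobolevNorm_zero]
  have hp : ∀ ξ, ‖weightedFourier (l * R) f ξ‖ₑ ^ 2 =
      (‖weightedFourier 0 f ξ‖ₑ ^ 2) ^ (1 - l) * (‖weightedFourier R f ξ‖ₑ ^ 2) ^ l := by
    intro ξ
    have hl : 0 ≤ 1 - l := by linarith
    simp only [enorm_weightedFourier, Real.rpow_zero, ENNReal.ofReal_one, one_mul, mul_pow]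
    rw [ENNReal.mul_rpow_of_nonneg _ _ h0, mul_left_comm, ← ENNReal.rpow_add_of_nonneg _ _ hl h0,
      sub_add_cancel, ENNReal.rpow_one, ← ENNReal.rpow_natCast (ENNReal.ofReal (bracket ξ ^ R)),
      ← ENNReal.rpow_mul, mul_comm _ l, ENNReal.rpow_mul,
      ENNReal.ofReal_rpow_of_nonneg (Real.rpow_nonneg (bracket_pos ξ).le R) h0,
      ← Real.rpow_mul (bracket_pos ξ).le, mul_comm R l, ENNReal.rpow_natCast]
  refine (ENNReal.pow_le_pow_left_iff two_ne_zero).1 ?_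
  rw [sobolevNorm_sq]
  simp_rw [hp]
  refine (ENNReal.lintegral_mul_norm_pow_le
    ((aestronglyMeasurable_weightedFourier 0 f).enorm.pow_const 2)
    ((aestronglyMeasurable_weightedFourier R f).enorm.pow_const 2)
    (by linarith) h0 (by ring)).trans_eq ?_
  rw [← sobolevNorm_sq, ← sobolevNorm_sq, mul_pow]
  simp only [← ENNReal.rpow_natCast, ← ENNReal.rpow_mul, mul_comm]

theorem Lpow_add {t : ℝ} (ht : t ≤ 0) (f g : L2 n) : Lpow t (f + g) = Lpow t f + Lpow t g := by
  apply ext_fourier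
  rw [FourierTransform.fourier_add]
  filter_upwards [fourier_Lpow (memLp_weightedFourier ht (f + g)),
    fourier_Lpow (memLp_weightedFourier ht f), fourier_Lpow (memLp_weightedFourier ht g),
    Lp.coeFn_add (𝓕 (Lpow t f) : L2 n) (𝓕 (Lpow t g)),
    Lp.coeFn_add (𝓕 f : L2 n) (𝓕 g)] with ξ e1 e2 e3 e4 e5
  rw [e1, e4, Pi.add_apply, e2, e3]
  simp only [weightedFourier]
  rw [FourierTransform.fourier_add, e5, Pi.add_apply]
  ring

theorem Lpow_smul {t : ℝ} (ht : t ≤ 0) (c : ℂ) (f : L2 n) : Lpow t (c • f) = c • Lpow t f := by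
  apply ext_fourier
  rw [FourierTransform.fourier_smul]
  filter_upwards [fourier_Lpow (memLp_weightedFourier ht (c • f)),
    fourier_Lpow (memLp_weightedFourier ht f),
    Lp.coeFn_smul c (𝓕 (Lpow t f) : L2 n), Lp.coeFn_smul c (𝓕 f : L2 n)] with ξ e1 e2 e4 e5
  rw [e1, e4, Pi.smul_apply, e2]
  simp only [weightedFourier]
  rw [FourierTransform.fourier_smul, e5, Pi.smul_apply, smul_eq_mul, smul_eq_mul]
  ring

theorem norm_Lpow_le {t : ℝ} (ht : t ≤ 0) (f : L2 n) : ‖Lpow t f‖ ≤ ‖f‖ := by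
  rw [← Lp.norm_fourier_eq f, ← Lp.norm_fourier_eq (Lpow t f)]
  refine Lp.norm_le_norm_of_ae_le ?_
  filter_upwards [fourier_Lpow (memLp_weightedFourier ht f)] with ξ hξ
  rw [hξ, weightedFourier, norm_mul, Complex.norm_real,
    Real.norm_of_nonneg (Real.rpow_nonneg (bracket_pos ξ).le t)]
  exact mul_le_of_le_one_left (norm_nonneg _)
    (Real.rpow_le_one_of_one_le_of_nonpos (one_le_bracket ξ) ht)

/-- The bounded operator `L^{-s}` on `L₂(ℝⁿ)`, for `s ≥ 0`. -/
noncomputable def besselPotential {s : ℝ} (hs : 0 ≤ s) : L2 n →L[ℂ] L2 n :=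
  LinearMap.mkContinuous
    { toFun := Lpow (-s)
      map_add' := Lpow_add (neg_nonpos.2 hs)
      map_smul' := Lpow_smul (neg_nonpos.2 hs) } 1
    fun f => by simpa using norm_Lpow_le (neg_nonpos.2 hs) f

@[simp]
theorem besselPotential_apply {s : ℝ} (hs : 0 ≤ s) (f : L2 n) :
    besselPotential hs f = Lpow (-s) f := rfl

theorem norm_besselPotential_le {s : ℝ} (hs : 0 ≤ s) :
    ‖(besselPotential hs : L2 n →L[ℂ] L2 n)‖ ≤ 1 :=
  LinearMap.mkContinuous_norm_le _ zero_le_one _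

theorem adjoint_besselPotential {s : ℝ} (hs : 0 ≤ s) :
    (besselPotential hs : L2 n →L[ℂ] L2 n).adjoint = besselPotential hs := by
  symm
  rw [ContinuousLinearMap.eq_adjoint_iff]
  intro f g
  rw [← Lp.inner_fourier_eq, ← Lp.inner_fourier_eq f, L2.inner_def, L2.inner_def]
  refine integral_congr_ae ?_
  filter_upwards [fourier_Lpow (memLp_weightedFourier (neg_nonpos.2 hs) f),
    fourier_Lpow (memLp_weightedFourier (neg_nonpos.2 hs) g)] with ξ e1 e2
  rw [besselPotential_apply, besselPotential_apply, e1, e2]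
  simp only [weightedFourier, RCLike.inner_apply, map_mul, Complex.conj_ofReal]
  ring

theorem sobolevNorm_besselPotential {s : ℝ} (hs : 0 ≤ s) (r : ℝ) (f : L2 n) :
    sobolevNorm r (besselPotential hs f) = sobolevNorm (r - s) f := by
  rw [besselPotential_apply, sobolevNorm_Lpow (memLp_weightedFourier (neg_nonpos.2 hs) f),
    sub_eq_add_neg]

theorem MemH.exists_besselPotential_eq {s : ℝ} (hs : 0 ≤ s) {f : L2 n} (hf : MemH s f) :
    ∃ g, besselPotential hs g = f :=
  ⟨Lpow s f, Lpow_neg_Lpow hf.memLp⟩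

end Sobolev

/-! ### Tikhonov regularisation in abstract Hilbert spaces -/

section Tikhonov

variable {H G : Type*} [NormedAddCommGroup H] [InnerProductSpace ℂ H]
  [NormedAddCommGroup G] [InnerProductSpace ℂ G]

/-- Euler equation: along the real line `u + t h` the functional changes by a quadratic in `t` that
is never negative, so its linear coefficient vanishes. -/
theorem re_inner_add_eq_zero_of_isMinOn {B : H →L[ℂ] G} {ρ : G} {α : ℝ} {u : H}
    (hu : ∀ h, ‖B u - ρ‖ ^ 2 + α * ‖u‖ ^ 2 ≤ ‖B h - ρ‖ ^ 2 + α * ‖h‖ ^ 2) (h : H) :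
    (inner ℂ (B u - ρ) (B h)).re + α * (inner ℂ u h).re = 0 := by
  set c := (inner ℂ (B u - ρ) (B h)).re + α * (inner ℂ u h).re with hc
  set d := ‖B h‖ ^ 2 + α * ‖h‖ ^ 2 with hd
  have key : ∀ t : ℝ, 0 ≤ 2 * t * c + t ^ 2 * d := by
    intro t
    have h1 := hu (u + (t : ℂ) • h)
    have e1 : B (u + (t : ℂ) • h) - ρ = (B u - ρ) + (t : ℂ) • B h := by
      rw [map_add, map_smul]; abel
    have e2 := norm_add_sq (𝕜 := ℂ) (B u - ρ) ((t : ℂ) • B h)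
    have e3 := norm_add_sq (𝕜 := ℂ) u ((t : ℂ) • h)
    rw [inner_smul_right, norm_smul] at e2 e3
    simp only [Complex.norm_real, RCLike.re_to_complex, Complex.re_ofReal_mul, mul_pow,
      Real.norm_eq_abs, sq_abs] at e2 e3
    rw [e1, e2, e3] at h1
    rw [hc, hd]
    linarith
  have hd0 : 0 < |d| + 1 := by positivity
  -- A step against the sign of `c`, short enough for the linear term to dominate; `|d| + 1` avoids
  -- cases on `d`.
  have h2 := key (-c / (|d| + 1))
  have h3 : 2 * (-c / (|d| + 1)) * c + (-c / (|d| + 1)) ^ 2 * d =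
      -(c ^ 2 * (2 * (|d| + 1) - d)) / (|d| + 1) ^ 2 := by
    field_simp
    ring
  rw [h3, le_div_iff₀ (by positivity)] at h2
  have h4 : 0 < 2 * (|d| + 1) - d := by linarith [le_abs_self d, abs_nonneg d]
  have h5 : c ^ 2 ≤ 0 := by
    by_contra hcon
    nlinarith [mul_pos (not_le.1 hcon) h4]
  exact pow_eq_zero_iff two_ne_zero |>.1 (le_antisymm h5 (sq_nonneg c))

/-- `B*B + α` is coercive, hence invertible. The vector `v - w` is the Tikhonov solution for the
exact data `B v`, so `w` is the bias. -/
theorem exists_regularized [CompleteSpace H] [CompleteSpace G] (B : H →L[ℂ] G) {α : ℝ} (hα : 0 < α) (v : H) :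
    ∃ w : H, ∀ h, inner ℂ (B w) (B h) + α * inner ℂ w h = α * inner ℂ v h := by
  set A : H →L[ℂ] H := B.adjoint ∘L B + (α : ℂ) • ContinuousLinearMap.id ℂ H with hA
  have hin : ∀ x h, inner ℂ (A x) h = inner ℂ (B x) (B h) + α * inner ℂ x h := by
    intro x h
    simp [hA, ContinuousLinearMap.adjoint_inner_left]
  have hunit : IsUnit A := by
    refine ContinuousLinearMap.isUnit_of_forall_le_norm_inner_map A
      (c := α.toNNReal) (Real.toNNReal_pos.2 hα) fun x => ?_
    refine le_trans ?_ (Complex.re_le_norm _)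
    rw [hin, inner_self_eq_norm_sq_to_K, inner_self_eq_norm_sq_to_K]
    norm_cast
    simp only [Real.coe_toNNReal _ hα.le, RCLike.ofReal_eq_complex_ofReal, Complex.add_re,
      Complex.re_ofReal_mul, Complex.ofReal_re]
    nlinarith [sq_nonneg ‖B x‖]
  obtain ⟨A', hA'⟩ := hunit.exists_right_inv
  refine ⟨A' ((α : ℂ) • v), fun h => ?_⟩
  have : A (A' ((α : ℂ) • v)) = (α : ℂ) • v := by
    rw [← mul_apply_eq_comp, hA', one_apply_eq_self]
  rw [← hin, this, inner_smul_left]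
  simp

theorem norm_regularized_le {B : H →L[ℂ] G} {α : ℝ} (hα : 0 < α) {v w : H}
    (hw : ∀ h, inner ℂ (B w) (B h) + α * inner ℂ w h = α * inner ℂ v h) :
    ‖B w‖ ^ 2 + α * ‖w‖ ^ 2 ≤ α * ‖inner ℂ v w‖ := by
  have h := congrArg Complex.re (hw w)
  rw [inner_self_eq_norm_sq_to_K, inner_self_eq_norm_sq_to_K] at h
  norm_cast at h
  simp only [Complex.add_re, Complex.re_ofReal_mul, Complex.ofReal_re,
    RCLike.ofReal_eq_complex_ofReal] at h
  rw [h]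
  exact mul_le_mul_of_nonneg_left (Complex.re_le_norm _) hα.le

/-- With `N² = x² + y²/α` one has `x ≤ N` and `y ≤ √α N`, so the hypothesis becomes `N² ≤ K √α^θ N`.
Used with `x = ‖w‖` and `y = ‖Bw‖`. -/
theorem sq_le_of_interpolation {x y α K θ : ℝ} (hx : 0 ≤ x) (hy : 0 ≤ y) (hα : 0 < α) (hK : 0 ≤ K)
    (h0 : 0 ≤ θ) (h1 : θ ≤ 1) (h : y ^ 2 + α * x ^ 2 ≤ α * (K * (y ^ θ * x ^ (1 - θ)))) :
    x ^ 2 ≤ K ^ 2 * α ^ θ := by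
  set N := Real.sqrt (x ^ 2 + y ^ 2 / α) with hN
  have hN2 : N ^ 2 = x ^ 2 + y ^ 2 / α := Real.sq_sqrt (by positivity)
  have hN0 : 0 ≤ N := Real.sqrt_nonneg _
  have hxN : x ≤ N := Real.le_sqrt_of_sq_le (by linarith [show 0 ≤ y ^ 2 / α by positivity])
  have hyN : y ≤ Real.sqrt α * N := by
    refine abs_le_of_sq_le_sq' ?_ (by positivity) |>.2
    rw [mul_pow, Real.sq_sqrt hα.le, hN2, mul_add, mul_div_cancel₀ _ hα.ne']
    nlinarith [sq_nonneg x]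
  have hle : y ^ θ * x ^ (1 - θ) ≤ Real.sqrt α ^ θ * N := by
    calc y ^ θ * x ^ (1 - θ) ≤ (Real.sqrt α * N) ^ θ * N ^ (1 - θ) := by
          gcongr
      _ = Real.sqrt α ^ θ * N := by
          rw [Real.mul_rpow (Real.sqrt_nonneg _) hN0, mul_assoc,
            ← Real.rpow_add_of_nonneg hN0 h0 (by linarith)]
          simp
  have hN3 : N ^ 2 ≤ K * Real.sqrt α ^ θ * N := by
    have : α * N ^ 2 = y ^ 2 + α * x ^ 2 := by
      rw [hN2, mul_add, mul_div_cancel₀ _ hα.ne']; ring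
    refine le_of_mul_le_mul_left ?_ hα
    rw [this]
    refine h.trans (mul_le_mul_of_nonneg_left ?_ hα.le)
    rw [mul_assoc]
    exact mul_le_mul_of_nonneg_left hle hK
  have hN4 : N ≤ K * Real.sqrt α ^ θ := by
    rcases hN0.eq_or_lt with h | h
    · rw [← h]; positivity
    · exact le_of_mul_le_mul_right (by linarith [sq N]) h
  have hs : (Real.sqrt α ^ θ) ^ 2 = α ^ θ := by
    rw [← Real.rpow_natCast, ← Real.rpow_mul (Real.sqrt_nonneg _), mul_comm,
      Real.rpow_mul (Real.sqrt_nonneg _), Real.rpow_natCast, Real.sq_sqrt hα.le]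
  calc x ^ 2 ≤ (K * Real.sqrt α ^ θ) ^ 2 := pow_le_pow_left₀ hx (hxN.trans hN4) 2
    _ = _ := by rw [mul_pow, hs]

/-- Stability of the Tikhonov-regularised solution under perturbation of the operator and of the
right-hand side. -/
theorem norm_sub_sq_le_of_isMinOn [CompleteSpace H] [CompleteSpace G] {S B : H →L[ℂ] G} {ρ : G} {α : ℝ} (hα : 0 < α) {u v w : H}
    (hu : ∀ h, ‖S u - ρ‖ ^ 2 + α * ‖u‖ ^ 2 ≤ ‖S h - ρ‖ ^ 2 + α * ‖h‖ ^ 2)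
    (hw : ∀ h, inner ℂ (B w) (B h) + α * inner ℂ w h = α * inner ℂ v h) :
    ‖u - v‖ ^ 2 ≤ 4 / α ^ 2 * ‖S.adjoint (ρ - S v)‖ ^ 2 + 2 * ‖w‖ ^ 2 +
      (4 * ‖B‖ ^ 2 + α) / α ^ 2 * (‖S - B‖ ^ 2 * ‖w‖ ^ 2) := by
  set x := u - v + w with hx
  set X := ‖S.adjoint (ρ - S v)‖
  set δ := ‖S - B‖
  have h1 := re_inner_add_eq_zero_of_isMinOn hu x
  have h2 := congrArg Complex.re (hw x)
  simp only [Complex.add_re, Complex.re_ofReal_mul] at h2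
  -- The sum of both equations tested with `x`; the mismatch `⟨Sw, Sx⟩ - ⟨Bw, Bx⟩` splits into two
  -- terms linear in `S - B`.
  have hid : ‖S x‖ ^ 2 + α * ‖x‖ ^ 2 = (inner ℂ (S.adjoint (ρ - S v)) x).re +
      (inner ℂ ((S - B) w) (S x)).re + (inner ℂ (B w) ((S - B) x)).re := by
    have e1 : ‖S x‖ ^ 2 = (inner ℂ (S x) (S x)).re := (inner_self_eq_norm_sq (𝕜 := ℂ) (S x)).symm
    have e2 : ‖x‖ ^ 2 = (inner ℂ x x).re := (inner_self_eq_norm_sq (𝕜 := ℂ) x).symm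
    have e3 : (inner ℂ (S x) (S x)).re = (inner ℂ (S u - ρ) (S x)).re +
        (inner ℂ (ρ - S v) (S x)).re + (inner ℂ (S w) (S x)).re := by
      rw [← Complex.add_re, ← Complex.add_re, ← inner_add_left, ← inner_add_left]
      congr 2
      rw [hx, map_add, map_sub]; abel
    have e4 : (inner ℂ x x).re = (inner ℂ u x).re - (inner ℂ v x).re + (inner ℂ w x).re := by
      rw [← Complex.sub_re, ← Complex.add_re, ← inner_sub_left, ← inner_add_left]
    rw [e1, e2, ContinuousLinearMap.adjoint_inner_left, e3, e4]
    simp only [sub_apply, inner_sub_left, inner_sub_right, Complex.sub_re] at h1 ⊢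
    linarith
  have b1 : (inner ℂ (S.adjoint (ρ - S v)) x).re ≤ X * ‖x‖ := re_inner_le_norm (𝕜 := ℂ) _ _
  have b2 : (inner ℂ ((S - B) w) (S x)).re ≤ δ * ‖w‖ * ‖S x‖ :=
    (re_inner_le_norm (𝕜 := ℂ) _ _).trans (by gcongr; exact (S - B).le_opNorm w)
  have b3 : (inner ℂ (B w) ((S - B) x)).re ≤ ‖B‖ * ‖w‖ * (δ * ‖x‖) :=
    (re_inner_le_norm (𝕜 := ℂ) _ _).trans
      (by gcongr; exacts [B.le_opNorm w, (S - B).le_opNorm x])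
  set k := δ * ‖w‖ with hk
  have hmain : α * ‖x‖ ^ 2 + ‖S x‖ ^ 2 ≤ (X + ‖B‖ * k) * ‖x‖ + k * ‖S x‖ := by
    rw [hk]; linarith
  -- Young's inequality on `2α` times `hmain`: `q2` absorbs `‖S x‖` entirely, so no bound on `‖S‖`
  -- enters.
  have h3 : α ^ 2 * ‖x‖ ^ 2 ≤ (X + ‖B‖ * k) ^ 2 + α / 2 * k ^ 2 := by
    have q1 := sq_nonneg (α * ‖x‖ - (X + ‖B‖ * k))
    have q2 := mul_nonneg hα.le (sq_nonneg (‖S x‖ - k / 2))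
    have q3 := mul_le_mul_of_nonneg_left hmain hα.le
    linarith
  have h4 : (X + ‖B‖ * k) ^ 2 ≤ 2 * X ^ 2 + 2 * ‖B‖ ^ 2 * k ^ 2 := by
    linarith [sq_nonneg (X - ‖B‖ * k)]
  have h5 : ‖u - v‖ ^ 2 ≤ 2 * ‖x‖ ^ 2 + 2 * ‖w‖ ^ 2 := by
    have e : u - v = x - w := by rw [hx]; abel
    have t := norm_sub_le x w
    rw [e]
    calc ‖x - w‖ ^ 2 ≤ (‖x‖ + ‖w‖) ^ 2 := by gcongr
      _ ≤ _ := by linarith [sq_nonneg (‖x‖ - ‖w‖)]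
  have h6 : ‖x‖ ^ 2 ≤ (2 * X ^ 2 + 2 * ‖B‖ ^ 2 * k ^ 2 + α / 2 * k ^ 2) / α ^ 2 := by
    rw [le_div_iff₀ (by positivity)]
    linarith
  have h7 : (2 * X ^ 2 + 2 * ‖B‖ ^ 2 * k ^ 2 + α / 2 * k ^ 2) / α ^ 2 * 2 =
      4 / α ^ 2 * X ^ 2 + (4 * ‖B‖ ^ 2 + α) / α ^ 2 * (δ ^ 2 * ‖w‖ ^ 2) := by
    rw [hk]
    field_simp
    ring
  linarith

end Tikhonov

/-! ### Measurability of random operator norms -/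

theorem enorm_eq_iSup_enorm_apply_div {E F : Type*} [NormedAddCommGroup E] [NormedSpace ℂ E]
    [NormedAddCommGroup F] [NormedSpace ℂ F] {x : ℕ → E} (hx : DenseRange x) (S : E →L[ℂ] F) :
    ‖S‖ₑ = ⨆ k, ‖S (x k)‖ₑ / ‖x k‖ₑ := by
  refine le_antisymm ?_ (iSup_le fun k => ENNReal.div_le_of_le_mul (S.le_opENorm _))
  set M := ⨆ k, ‖S (x k)‖ₑ / ‖x k‖ₑ with hM
  rcases eq_or_ne M ⊤ with h | h
  · rw [h]; exact le_top
  have hk : ∀ y, ‖S y‖ ≤ M.toReal * ‖y‖ := by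
    intro y
    refine hx.induction_on (p := fun y => ‖S y‖ ≤ M.toReal * ‖y‖) y
      (isClosed_le (by fun_prop) (by fun_prop)) fun k => ?_
    rcases eq_or_ne (x k) 0 with h0 | h0
    · simp [h0]
    have h1 : ‖S (x k)‖ₑ ≤ M * ‖x k‖ₑ :=
      (ENNReal.div_le_iff (by simpa using h0) enorm_ne_top).1
        (le_iSup (fun k => ‖S (x k)‖ₑ / ‖x k‖ₑ) k)
    simpa using ENNReal.toReal_mono (ENNReal.mul_ne_top h enorm_ne_top) h1
  have := S.opNorm_le_bound ENNReal.toReal_nonneg hk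
  rw [← ofReal_norm]
  exact ENNReal.ofReal_le_of_le_toReal this

/-- Separability makes the operator norm a countable supremum, so pointwise measurability of `S`
suffices. -/
theorem aemeasurable_enorm_of_forall_apply {E F Ω : Type*} [NormedAddCommGroup E]
    [NormedSpace ℂ E] [TopologicalSpace.SeparableSpace E] [NormedAddCommGroup F]
    [NormedSpace ℂ F] [MeasurableSpace Ω] {P : Measure Ω} {S : Ω → E →L[ℂ] F}
    (hS : ∀ x, AEStronglyMeasurable (fun ω => S ω x) P) : AEMeasurable (fun ω => ‖S ω‖ₑ) P := by
  simp_rw [enorm_eq_iSup_enorm_apply_div (TopologicalSpace.denseRange_denseSeq E)]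
  exact AEMeasurable.iSup fun k => (hS _).enorm.div_const _

/-! ### Bias and error bounds in the Sobolev scale -/

section Rates

variable {p q : ℕ}

/-- The smoothing property is used from below at order `a + 2s - b` and from above at order `a + s`,
with interpolation of `T J w` in between. -/
theorem exists_interpolation_bound {a b s : ℝ} (ha : 0 < a) (hs : 0 ≤ s)
    (hsab : (b - a) / 2 ≤ s) (hsb : s ≤ b) {T : L2 p →L[ℂ] L2 q}
    (hT : SmoothsAt T a (a + 2 * s - b)) (hT' : SmoothsAt T a (a + s)) :
    ∃ K : ℝ≥0, ∀ w : L2 p, sobolevNorm (-(b - s)) w ≤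
      K * (‖T (besselPotential hs w)‖ₑ ^ ((b - s) / (a + s)) *
        ‖w‖ₑ ^ (1 - (b - s) / (a + s))) := by
  obtain ⟨c, _, hc, _, h1⟩ := hT
  obtain ⟨_, C, _, _, h2⟩ := hT'
  have has : 0 < a + s := by linarith
  set θ := (b - s) / (a + s) with hθ
  have hθ0 : 0 ≤ θ := div_nonneg (by linarith) has.le
  -- Equivalent to `s ≥ (b - a)/2`, that is, to the intermediate order `a + 2s - b` being
  -- nonnegative.
  have hθ1 : θ ≤ 1 := (div_le_one has).2 (by linarith)
  have hl : (1 - θ) * (a + s) = a + 2 * s - b := by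
    rw [hθ]; field_simp; ring
  refine ⟨c⁻¹ * C ^ (1 - θ), fun w => ?_⟩
  have e1 := (h1 (besselPotential hs w)).1
  have e2 := (h2 (besselPotential hs w)).2
  have e3 := sobolevNorm_interpolation (l := 1 - θ) (by linarith) (by linarith) (a + s)
    (T (besselPotential hs w))
  rw [sobolevNorm_besselPotential] at e1 e2
  rw [hl, sub_sub_cancel] at e3
  rw [show a + 2 * s - b - a - s = -(b - s) by ring] at e1
  rw [show a + s - a - s = 0 by ring, sobolevNorm_zero] at e2
  have hc' : (c : ℝ≥0∞) ≠ 0 := by exact_mod_cast hc.ne'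
  calc sobolevNorm (-(b - s)) w = (c : ℝ≥0∞)⁻¹ * (c * sobolevNorm (-(b - s)) w) := by
        rw [← mul_assoc, ENNReal.inv_mul_cancel hc' ENNReal.coe_ne_top, one_mul]
    _ ≤ (c : ℝ≥0∞)⁻¹ * (‖T (besselPotential hs w)‖ₑ ^ θ * (C * ‖w‖ₑ) ^ (1 - θ)) := by
        refine mul_le_mul_right ((e1.trans e3).trans ?_) _
        exact mul_le_mul_right (ENNReal.rpow_le_rpow e2 (by linarith)) _
    _ = _ := by
        rw [ENNReal.mul_rpow_of_nonneg _ _ (by linarith), ENNReal.coe_mul, ENNReal.coe_inv hc.ne',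
          ENNReal.coe_rpow_of_nonneg _ (by linarith)]
        ring

/-- The bias of Tikhonov regularisation in the scale of Sobolev spaces. -/
theorem exists_bias_bound {a b s M : ℝ} (ha : 0 < a) (hs : 0 < s) (hsab : (b - a) / 2 ≤ s)
    (hM : 0 < M) {T : L2 p →L[ℂ] L2 q} (hT : ∀ r : ℝ, 0 < r → SmoothsAt T a r)
    (hT_boundary : s = (b - a) / 2 → SmoothsAt T a 0) {v : L2 p} (hv : MemH (b - s) v) :
    ∃ K : ℝ, 0 ≤ K ∧ ∀ α : ℝ, 0 < α → α ≤ M → ∀ w : L2 p,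
      (∀ h, inner ℂ (T (besselPotential hs.le w)) (T (besselPotential hs.le h)) +
        α * inner ℂ w h = α * inner ℂ v h) →
      ‖w‖ ^ 2 ≤ K * α ^ ((b - s) / (a + s)) := by
  have has : 0 < a + s := by linarith
  -- For `b < s` the exponent is negative, so `α ≤ M` bounds `α^{(b-s)/(a+s)}` below and `‖w‖ ≤ ‖v‖`
  -- is enough.
  rcases lt_or_ge b s with hbs | hsb
  · have hexp : (b - s) / (a + s) ≤ 0 := div_nonpos_of_nonpos_of_nonneg (by linarith) has.le
    refine ⟨‖v‖ ^ 2 / M ^ ((b - s) / (a + s)), by positivity, fun α hα hαM w hw => ?_⟩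
    have h1 := norm_regularized_le (B := T ∘L besselPotential hs.le) hα hw
    have h2 : ‖w‖ ^ 2 ≤ ‖v‖ * ‖w‖ := by
      refine le_of_mul_le_mul_left ?_ hα
      have := mul_le_mul_of_nonneg_left (norm_inner_le_norm (𝕜 := ℂ) v w) hα.le
      nlinarith [sq_nonneg ‖(T ∘L besselPotential hs.le) w‖]
    have h3 : ‖w‖ ^ 2 ≤ ‖v‖ ^ 2 := by nlinarith [sq_nonneg (‖v‖ - ‖w‖)]
    rw [div_mul_eq_mul_div, le_div_iff₀ (by positivity)]
    exact mul_le_mul h3 (Real.rpow_le_rpow_of_nonpos hα hαM hexp) (by positivity) (by positivity)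
  · have hr : SmoothsAt T a (a + 2 * s - b) := by
      rcases hsab.eq_or_lt with h | h
      · rw [show a + 2 * s - b = 0 by linarith]
        exact hT_boundary h.symm
      · exact hT _ (by linarith)
    obtain ⟨K, hK⟩ := exists_interpolation_bound ha hs.le hsab hsb hr (hT _ has)
    have hθ0 : 0 ≤ (b - s) / (a + s) := div_nonneg (by linarith) has.le
    have hθ1 : (b - s) / (a + s) ≤ 1 := (div_le_one has).2 (by linarith)
    set V := (sobolevNorm (b - s) v).toReal
    refine ⟨(V * K) ^ 2, by positivity, fun α hα _ w hw => ?_⟩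
    have h1 := norm_regularized_le (B := T ∘L besselPotential hs.le) hα hw
    refine sq_le_of_interpolation (norm_nonneg w)
      (norm_nonneg ((T ∘L besselPotential hs.le) w)) hα (by positivity) hθ0 hθ1
      (h1.trans (mul_le_mul_of_nonneg_left ?_ hα.le))
    have h2 : ‖inner ℂ v w‖ₑ ≤ sobolevNorm (b - s) v * (K *
        (‖T (besselPotential hs.le w)‖ₑ ^ ((b - s) / (a + s)) *
          ‖w‖ₑ ^ (1 - (b - s) / (a + s)))) :=
      (enorm_inner_le_sobolevNorm_mul (b - s) v w).trans (mul_le_mul_right (hK w) _)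
    have h3 := ENNReal.toReal_mono (by
      have h4 := ENNReal.rpow_ne_top_of_nonneg hθ0
        (enorm_ne_top (x := T (besselPotential hs.le w)))
      have h5 := ENNReal.rpow_ne_top_of_nonneg (sub_nonneg.2 hθ1) (enorm_ne_top (x := w))
      exact ENNReal.mul_ne_top hv.ne (ENNReal.mul_ne_top ENNReal.coe_ne_top
        (ENNReal.mul_ne_top h4 h5))) h2
    simpa [ENNReal.toReal_mul, ← ENNReal.toReal_rpow, mul_assoc] using h3

theorem tikhonovFunctional_besselPotential {s α : ℝ} (hs : 0 ≤ s) (hα : 0 ≤ α)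
    (S : L2 p →L[ℂ] L2 q) (ρ : L2 q) (u : L2 p) :
    tikhonovFunctional s α S ρ (besselPotential hs u) =
      ENNReal.ofReal (‖(S ∘L besselPotential hs) u - ρ‖ ^ 2 + α * ‖u‖ ^ 2) := by
  rw [tikhonovFunctional, sobolevNorm_besselPotential, sub_self, sobolevNorm_zero,
    ENNReal.ofReal_add (by positivity) (by positivity), ENNReal.ofReal_mul hα,
    ENNReal.ofReal_pow (norm_nonneg _), ENNReal.ofReal_pow (norm_nonneg _), ofReal_norm,
    ofReal_norm]
  rfl

theorem IsTikhonovSolution.exists_isMinOn {s α : ℝ} (hs : 0 ≤ s) (hα : 0 < α)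
    {S : L2 p →L[ℂ] L2 q} {ρ : L2 q} {f : L2 p} (hf : IsTikhonovSolution s α S ρ f) :
    ∃ u, besselPotential hs u = f ∧ ∀ h,
      ‖(S ∘L besselPotential hs) u - ρ‖ ^ 2 + α * ‖u‖ ^ 2 ≤
        ‖(S ∘L besselPotential hs) h - ρ‖ ^ 2 + α * ‖h‖ ^ 2 := by
  have hfin : MemH s f := by
    -- Comparison with `0` makes the minimum finite, which forces `f ∈ H^s`.
    have h0 := hf (besselPotential hs 0)
    rw [tikhonovFunctional_besselPotential hs hα.le] at h0
    have h1 := (le_add_self.trans h0).trans_lt ENNReal.ofReal_lt_top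
    by_contra hcon
    rw [MemH, not_lt_top_iff] at hcon
    simp [hcon, hα] at h1
  obtain ⟨u, rfl⟩ := hfin.exists_besselPotential_eq hs
  refine ⟨u, rfl, fun h => ?_⟩
  have h0 := hf (besselPotential hs h)
  rw [tikhonovFunctional_besselPotential hs hα.le, tikhonovFunctional_besselPotential hs hα.le,
    ENNReal.ofReal_le_ofReal_iff (by positivity)] at h0
  exact h0

/-- The deterministic error bound behind the convergence rate: the constant is uniform over the
perturbed operators, the right-hand sides and the bounded regularisation parameters. -/
theorem exists_tikhonov_error_bound {a b s M : ℝ} (ha : 0 < a) (hs : 0 < s)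
    (hsab : (b - a) / 2 ≤ s) (hM : 0 < M) {T : L2 p →L[ℂ] L2 q}
    (hT : ∀ r : ℝ, 0 < r → SmoothsAt T a r) (hT_boundary : s = (b - a) / 2 → SmoothsAt T a 0)
    {φ : L2 p} (hφb : MemH b φ) (hφs : MemH s φ) :
    ∃ C : ℝ≥0, ∀ α : ℝ, 0 < α → α ≤ M → ∀ (S : L2 p →L[ℂ] L2 q) (ρ : L2 q) (f : L2 p),
      IsTikhonovSolution s α S ρ f → sobolevNorm s (f - φ) ^ 2 ≤
        C * (ENNReal.ofReal (1 / α ^ 2) * ‖Lpow (-s) (S.adjoint (ρ - S φ))‖ₑ ^ 2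
          + ENNReal.ofReal (α ^ ((b - s) / (a + s)))
          + ENNReal.ofReal (1 / α ^ 2) * ‖S - T‖ₑ ^ 2 *
            ENNReal.ofReal (α ^ ((b - s) / (a + s)))) := by
  obtain ⟨v, rfl⟩ := hφs.exists_besselPotential_eq hs.le
  have hv : MemH (b - s) v := by
    rwa [MemH, sobolevNorm_besselPotential] at hφb
  obtain ⟨K, hK0, hK⟩ := exists_bias_bound ha hs hsab hM hT hT_boundary hv
  set J : L2 p →L[ℂ] L2 p := besselPotential hs.le with hJ
  set D := 4 * ‖T ∘L J‖ ^ 2 + M with hD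
  have hD0 : 0 ≤ D := by positivity
  -- The summands serve the residual, the bias and the operator error; `D` dominates `4‖B‖² + α`.
  refine ⟨(4 + 2 * K + D * K).toNNReal, fun α hα hαM S ρ f hf => ?_⟩
  obtain ⟨u, rfl, hu⟩ := hf.exists_isMinOn hs.le hα
  obtain ⟨w, hw⟩ := exists_regularized (T ∘L J) hα v
  have hw2 := hK α hα hαM w hw
  have hmain := norm_sub_sq_le_of_isMinOn hα hu hw
  have hadj : (S ∘L J).adjoint (ρ - (S ∘L J) v) = Lpow (-s) (S.adjoint (ρ - S (J v))) := by
    rw [ContinuousLinearMap.adjoint_comp, hJ, adjoint_besselPotential]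
    rfl
  have hdiff : ‖S ∘L J - T ∘L J‖ ≤ ‖S - T‖ := by
    rw [← ContinuousLinearMap.sub_comp]
    exact (ContinuousLinearMap.opNorm_comp_le _ _).trans
      (mul_le_of_le_one_right (norm_nonneg _) (norm_besselPotential_le hs.le))
  rw [← hJ, hadj] at hmain
  set X := ‖Lpow (-s) (S.adjoint (ρ - S (J v)))‖
  set E := α ^ ((b - s) / (a + s))
  have hE : 0 ≤ E := by positivity
  have hreal : ‖u - v‖ ^ 2 ≤ (4 + 2 * K + D * K) *
      (1 / α ^ 2 * X ^ 2 + E + 1 / α ^ 2 * ‖S - T‖ ^ 2 * E) := by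
    have t1 : 4 / α ^ 2 * X ^ 2 ≤ (4 + 2 * K + D * K) * (1 / α ^ 2 * X ^ 2) := by
      rw [div_eq_mul_one_div, mul_assoc]
      gcongr
      nlinarith [mul_nonneg hD0 hK0]
    have t2 : 2 * ‖w‖ ^ 2 ≤ (4 + 2 * K + D * K) * E := by
      nlinarith [mul_nonneg (mul_nonneg hD0 hK0) hE]
    have t3 : (4 * ‖T ∘L J‖ ^ 2 + α) / α ^ 2 * (‖S ∘L J - T ∘L J‖ ^ 2 * ‖w‖ ^ 2) ≤
        (4 + 2 * K + D * K) * (1 / α ^ 2 * ‖S - T‖ ^ 2 * E) := by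
      calc _ ≤ D / α ^ 2 * (‖S - T‖ ^ 2 * (K * E)) := by
            rw [hD]
            gcongr
        _ = D * K * (1 / α ^ 2 * ‖S - T‖ ^ 2 * E) := by ring
        _ ≤ _ := by
          gcongr
          linarith
    rw [mul_add, mul_add]
    linarith
  have hlhs : sobolevNorm s (J u - J v) ^ 2 = ENNReal.ofReal (‖u - v‖ ^ 2) := by
    rw [← map_sub, sobolevNorm_besselPotential, sub_self, sobolevNorm_zero,
      ENNReal.ofReal_pow (norm_nonneg _), ofReal_norm]
  rw [hlhs]
  refine (ENNReal.ofReal_le_ofReal hreal).trans_eq ?_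
  rw [ENNReal.ofReal_mul (by positivity)]
  refine congrArg (ENNReal.ofReal (4 + 2 * K + D * K) * ·) ?_
  rw [ENNReal.ofReal_add (by positivity) (by positivity), ENNReal.ofReal_add (by positivity) hE, ENNReal.ofReal_mul (by positivity),
    ENNReal.ofReal_mul (by positivity), ENNReal.ofReal_mul (by positivity),
    ENNReal.ofReal_pow (norm_nonneg _), ENNReal.ofReal_pow (norm_nonneg _), ofReal_norm,
    ofReal_norm]

end Rates

/-! ### Taking expectations -/

theorem theorem1 {p q : ℕ} {Ω : Type*} [MeasurableSpace Ω] (P : Measure Ω)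
    [IsProbabilityMeasure P]
    (a b s : ℝ) (ha : 0 < a) (hb : 0 < b) (hs : 0 < s) (hsab : (b - a) / 2 ≤ s)
    -- the operator smooths by `a`
    (T : L2 p →L[ℂ] L2 q)
    (hT : ∀ r : ℝ, 0 < r → SmoothsAt T a r)
    (hT_boundary : s = (b - a) / 2 → SmoothsAt T a 0)
    -- the target has smoothness `b`, and a finite `s`-norm (automatic if `s ≤ b`)
    (φ : L2 p) (hφb : MemH b φ) (hφs : MemH s φ)
    -- regularisation parameters, estimated operators and right-hand sides
    (α : ℕ → ℝ) (hα_pos : ∀ n, 0 < α n) (hα_bdd : BddAbove (Set.range α))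
    (That : ℕ → Ω → (L2 p →L[ℂ] L2 q)) (rhat : ℕ → Ω → L2 q)
    (hThat : ∀ n (ψ : L2 p), AEStronglyMeasurable (fun ω => That n ω ψ) P)
    (hrhat : ∀ n, AEStronglyMeasurable (rhat n) P)
    -- the Tikhonov estimators
    (φhat : ℕ → Ω → L2 p)
    (hφhat : ∀ n, ∀ᵐ ω ∂P, IsTikhonovSolution s (α n) (That n ω) (rhat n ω) (φhat n ω)) :
    ∃ C : ℝ≥0, ∀ n : ℕ,
      ∫⁻ ω, sobolevNorm s (φhat n ω - φ) ^ 2 ∂P ≤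
        C * (ENNReal.ofReal (1 / α n ^ 2) *
              ∫⁻ ω, ‖Lpow (-s) ((That n ω).adjoint (rhat n ω - That n ω φ))‖ₑ ^ 2 ∂P
            + ENNReal.ofReal (α n ^ ((b - s) / (a + s)))
            + ENNReal.ofReal (1 / α n ^ 2) *
              (∫⁻ ω, ‖That n ω - T‖ₑ ^ 2 ∂P
                + ∫⁻ ω, ‖(That n ω).adjoint - T.adjoint‖ₑ ^ 2 ∂P) *
              ENNReal.ofReal (α n ^ ((b - s) / (a + s)))) := by

  obtain ⟨M, hM⟩ := hα_bdd
  have hαM : ∀ n, α n ≤ M := fun n => hM ⟨n, rfl⟩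
  obtain ⟨C, hC⟩ := exists_tikhonov_error_bound ha hs hsab ((hα_pos 0).trans_le (hαM 0)) hT
    hT_boundary hφb hφs
  refine ⟨C, fun n => ?_⟩
  have : Fact ((2 : ℝ≥0∞) ≠ ⊤) := ⟨ENNReal.ofNat_ne_top⟩
  have hmeas : AEMeasurable (fun ω => ‖That n ω - T‖ₑ) P :=
    aemeasurable_enorm_of_forall_apply fun x =>
      (hThat n x).sub (aestronglyMeasurable_const (b := T x))
  set A := ENNReal.ofReal (1 / α n ^ 2)
  set E := ENNReal.ofReal (α n ^ ((b - s) / (a + s)))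
  calc ∫⁻ ω, sobolevNorm s (φhat n ω - φ) ^ 2 ∂P
      ≤ ∫⁻ ω, C * (A * ‖Lpow (-s) ((That n ω).adjoint (rhat n ω - That n ω φ))‖ₑ ^ 2 + E
          + A * ‖That n ω - T‖ₑ ^ 2 * E) ∂P := by
        refine lintegral_mono_ae ?_
        filter_upwards [hφhat n] with ω hω
        exact hC (α n) (hα_pos n) (hαM n) _ _ _ hω
    _ = C * (A * ∫⁻ ω, ‖Lpow (-s) ((That n ω).adjoint (rhat n ω - That n ω φ))‖ₑ ^ 2 ∂P + E
          + A * (∫⁻ ω, ‖That n ω - T‖ₑ ^ 2 ∂P) * E) := by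
        -- Additivity needs measurability of one summand only, so none is required of the residual
        -- term.
        rw [lintegral_const_mul' _ _ ENNReal.coe_ne_top,
          lintegral_add_right' _ (((hmeas.pow_const 2).const_mul A).mul_const E),
          lintegral_add_right' _ aemeasurable_const, lintegral_const_mul' _ _ ENNReal.ofReal_ne_top,
          lintegral_mul_const' _ _ ENNReal.ofReal_ne_top,
          lintegral_const_mul' _ _ ENNReal.ofReal_ne_top, lintegral_const, measure_univ, mul_one]
    _ ≤ _ := by
        gcongr
        -- The adjoint term is simply added on the right.
        exact le_self_add
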